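/- Let $k\ge 2$ and let $(M,g;\mathcal D_1,\dots,\mathcal D_k)$ and $(\bar M,\bar g;\bar{\mathcal D}_1,\dots,\bar{\mathcal D}_k)$ be Riemannian almost $k$-product manifolds, i.e. smooth (finite-dimensional, boundaryless) Riemannian manifolds with $k$ pairwise orthogonal smooth distributions whose sum is the whole tangent bundle; let $n_i$ be the rank of $\mathcal D_i$. Let $f:M\to\bar M$ be an adapted isometric immersion, i.e. a smooth isometric immersion with $f_*(\mathcal D_i(x))\subset\bar{\mathcal D}_i(f(x))$ for all $x\in M$ and all $i$. For pairwise orthogonal subspaces $V_1,\dots,V_k$ of a tangent space of a Riemannian manifold put $$\mathrm S_{\rm mix}(V_1,\dots,V_k)=\sum_{i<j}\ \sum_{a,b}K\big(e^{(i)}_a,e^{(j)}_b\big),$$ where $(e^{(i)}_a)_a$ is any orthonormal basis of $V_i$ and $K(X,Y)=g(R(X,Y)Y,X)$ with $R(X,Y)=[\nabla_X,\nabla_Y]-\nabla_{[X,Y]}$. The mixed scalar curvature of $M$ is the function $\mathrm S_{\rm mix}(\mathcal D_1,\dots,\mathcal D_k)(x)=\mathrm S_{\rm mix}(\mathcal D_1(x),\dots,\mathcal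 D_k(x))$; the same quantity computed with the curvature of $\bar M$ is denoted $\hat{\mathrm S}_{\rm mix}$. Let $$\hat\delta_{\rm mix}(n_1,\dots,n_k)=\sup\big\{\hat{\mathrm S}_{\rm mix}(V_1,\dots,V_k)\ :\ y\in\bar M,\ V_i\subset\bar{\mathcal D}_i(y),\ \dim V_i=n_i\big\}\in[-\infty,+\infty].$$ Let $\bar h$ be the second fundamental form of $f$, let $\bar H_i=\sum_a\bar h(e^{(i)}_a,e^{(i)}_a)$ be its trace over an orthonormal basis of $\mathcal D_i(x)$, and let $\bar H=\operatorname{tr}_g\bar h$ (the unnormalized mean curvature vector). Then at every point of $M$ $$\mathrm S_{\rm mix}(\mathcal D_1,\dots,\mathcal D_k)\ \le\ \frac{k-1}{2k}\,\|\bar H\|^2+\hat\delta_{\rm mix}(n_1,\dots,n_k).$$ Equality holds at a point $x\in M$ if and only if, at $x$, $\bar h(X,Y)=0$ for all $X\in\mathcal D_i(x)$, $Y\in\mathcal D_j(x)$, $i\ne j$, $\bar H_1=\dots=\bar H_k$, and $\hat{\mathrm S}_{\rm mix}(f_*\mathcal D_1(x),\dots,f_*\mathcal D_k(x))=\hat\delta_{\rm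 mix}(n_1,\dots,n_k)$. Consequently equality holds at every point of $M$ if and only if $f$ is mixed totally geodesic (i.e. $\bar h(X,Y)=0$ for all $X\in\mathcal D_i$, $Y\in\mathcal D_j$, $i\neq j$), $\bar H_1=\dots=\bar H_k$ on $M$, and $\hat{\mathrm S}_{\rm mix}(f_*\mathcal D_1(x),\dots,f_*\mathcal D_k(x))=\hat\delta_{\rm mix}(n_1,\dots,n_k)$ for every $x\in M$. -/

import Mathlib

open Bundle
open scoped Manifold ContDiff InnerProductSpace Topology

set_option maxSynthPendingDepth 3

noncomputable section

namespace AlmostProduct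

/-! ### Levi-Civita connection and curvature of a metric on an open set of a vector space -/

section Local

variable {E : Type*} [NormedAddCommGroup E] [NormedSpace ℝ E]

/-- The lowered Christoffel symbols (Koszul formula for constant vector fields) of a field `G` of
bilinear forms: `koszul G y u v w = (D_u G (v, w) + D_v G (u, w) - D_w G (u, v)) / 2`. -/
def koszul (G : E → E →L[ℝ] E →L[ℝ] ℝ) (y : E) : E →L[ℝ] E →L[ℝ] E →L[ℝ] ℝ :=
  let A : E →L[ℝ] E →L[ℝ] E →L[ℝ] ℝ := fderiv ℝ G y
  let B : E →L[ℝ] E →L[ℝ] E →L[ℝ] ℝ := A.flip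
  let C : E →L[ℝ] E →L[ℝ] E →L[ℝ] ℝ :=
    (ContinuousLinearMap.flipₗᵢ ℝ E E ℝ).toContinuousLinearEquiv.toContinuousLinearMap.comp B
  (1 / 2 : ℝ) • (A + B - C)

theorem koszul_apply (G : E → E →L[ℝ] E →L[ℝ] ℝ) (y u v w : E) :
    koszul G y u v w =
      (1 / 2) * (fderiv ℝ G y u v w + fderiv ℝ G y v u w - fderiv ℝ G y w u v) := by
  simp [koszul]

/-- The Christoffel symbols of the Levi-Civita connection of the metric `G`: the vector
`christoffel G y u v` is `∇_u v` at `y` for constant vector fields `u`, `v`. It is obtained from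
`koszul` by raising the last index, i.e. by the inverse of `G y : E → E*`. -/
def christoffel (G : E → E →L[ℝ] E →L[ℝ] ℝ) (y : E) : E →L[ℝ] E →L[ℝ] E :=
  (ContinuousLinearMap.compL ℝ E (E →L[ℝ] ℝ) E (G y).inverse) ∘L koszul G y

/-- The curvature tensor `R(u, v) w = ∇_u ∇_v w - ∇_v ∇_u w` (for constant `u`, `v`, `w`). -/
def localCurvature (G : E → E →L[ℝ] E →L[ℝ] ℝ) (y u v w : E) : E :=
  fderiv ℝ (christoffel G) y u v w - fderiv ℝ (christoffel G) y v u w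
    + christoffel G y u (christoffel G y v w) - christoffel G y v (christoffel G y u w)

end Local

/-! ### Riemannian manifolds -/

section Manifold

variable {E : Type*} [NormedAddCommGroup E] [NormedSpace ℝ E]
  {M : Type*} [TopologicalSpace M] [ChartedSpace E M] [IsManifold 𝓘(ℝ, E) ∞ M]

/-- The coordinates of a tangent vector at `x` in the preferred chart at `p`. -/
abbrev toCoord (p x : M) : TangentSpace 𝓘(ℝ, E) x →L[ℝ] E :=
  (trivializationAt E (TangentSpace 𝓘(ℝ, E) : M → Type _) p).continuousLinearMapAt ℝ x

/-- The tangent vector at `x` with given coordinates in the preferred chart at `p`. -/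
abbrev ofCoord (p x : M) : E →L[ℝ] TangentSpace 𝓘(ℝ, E) x :=
  (trivializationAt E (TangentSpace 𝓘(ℝ, E) : M → Type _) p).symmL ℝ x

instance [FiniteDimensional ℝ E] (x : M) : FiniteDimensional ℝ (TangentSpace 𝓘(ℝ, E) x) :=
  inferInstanceAs (FiniteDimensional ℝ E)

variable [RiemannianBundle (fun x : M ↦ TangentSpace 𝓘(ℝ, E) x)]

/-- The Riemannian metric of `M` written in the preferred chart at `p`, as a field of bilinear
forms on (the target of the chart in) `E`. -/
def chartMetric (p : M) (y : E) : E →L[ℝ] E →L[ℝ] ℝ :=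
  (innerSL ℝ (E := TangentSpace 𝓘(ℝ, E) ((extChartAt 𝓘(ℝ, E) p).symm y))).bilinearComp
    (ofCoord p ((extChartAt 𝓘(ℝ, E) p).symm y)) (ofCoord p ((extChartAt 𝓘(ℝ, E) p).symm y))

/-- The Riemann curvature tensor `R(X, Y) Z` of `M` at `x`, computed in the preferred chart. -/
def curvature (x : M) (X Y Z : TangentSpace 𝓘(ℝ, E) x) : TangentSpace 𝓘(ℝ, E) x :=
  ofCoord x x (localCurvature (chartMetric x) (extChartAt 𝓘(ℝ, E) x x)
    (toCoord x x X) (toCoord x x Y) (toCoord x x Z))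

/-- `K(X, Y) = g(R(X, Y) Y, X)`, the sectional curvature of the plane spanned by an orthonormal
pair `X`, `Y`. -/
def sectional (x : M) (X Y : TangentSpace 𝓘(ℝ, E) x) : ℝ :=
  ⟪curvature x X Y Y, X⟫_ℝ

variable [FiniteDimensional ℝ E]

/-- The mixed scalar curvature `S_mix(V, W) = ∑_{a, b} K(e_a, e_b)` of a pair of subspaces of
`T_x M`, where `(e_a)` and `(e_b)` are orthonormal bases of `V` and `W`. It does not depend on the
bases, see `mixedScalarPair_eq`. -/
def mixedScalarPair (x : M) (V W : Submodule ℝ (TangentSpace 𝓘(ℝ, E) x)) : ℝ :=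
  ∑ a, ∑ b, sectional x (stdOrthonormalBasis ℝ V a : TangentSpace 𝓘(ℝ, E) x)
    (stdOrthonormalBasis ℝ W b : TangentSpace 𝓘(ℝ, E) x)

/-- The mixed scalar curvature `S_mix(V_1, …, V_k) = ∑_{i < j} S_mix(V_i, V_j)` of pairwise
orthogonal subspaces of `T_x M`. -/
def mixedScalar {k : ℕ} (x : M) (V : Fin k → Submodule ℝ (TangentSpace 𝓘(ℝ, E) x)) : ℝ :=
  ∑ i, ∑ j, if i < j then mixedScalarPair x (V i) (V j) else 0

theorem sum_bilin_orthonormalBasis {T : Type*} [NormedAddCommGroup T] [InnerProductSpace ℝ T]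
    {ι κ : Type*} [Fintype ι] [Fintype κ] (B : T →ₗ[ℝ] T →ₗ[ℝ] ℝ)
    (b : OrthonormalBasis ι ℝ T) (c : OrthonormalBasis κ ℝ T) :
    ∑ i, B (b i) (b i) = ∑ j, B (c j) (c j) := by
  have h1 : ∀ i, B (b i) (b i) = ∑ j, ∑ l, ⟪c j, b i⟫_ℝ * ⟪b i, c l⟫_ℝ * B (c j) (c l) := by
    intro i
    conv_lhs => rw [← c.sum_repr' (b i)]
    simp only [map_sum, map_smul, LinearMap.sum_apply, LinearMap.smul_apply, smul_eq_mul]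
    rw [Finset.sum_comm]
    refine Finset.sum_congr rfl fun j _ ↦ ?_
    simp only [Finset.mul_sum]
    refine Finset.sum_congr rfl fun l _ ↦ ?_
    rw [real_inner_comm (b i) (c j)]
    ring
  simp only [h1]
  rw [Finset.sum_comm]
  refine Finset.sum_congr rfl fun j _ ↦ ?_
  rw [Finset.sum_comm]
  simp only [← Finset.sum_mul, b.sum_inner_mul_inner]
  classical
  simp [c.inner_eq_ite]

/-- The mixed scalar curvature of a pair can be computed in any orthonormal bases. -/
theorem mixedScalarPair_eq (x : M) (V W : Submodule ℝ (TangentSpace 𝓘(ℝ, E) x))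
    {ι κ : Type*} [Fintype ι] [Fintype κ] (b : OrthonormalBasis ι ℝ V)
    (c : OrthonormalBasis κ ℝ W) :
    mixedScalarPair x V W = ∑ i, ∑ j, sectional x (b i : TangentSpace 𝓘(ℝ, E) x)
      (c j : TangentSpace 𝓘(ℝ, E) x) := by
  have hV : ∀ Y : TangentSpace 𝓘(ℝ, E) x,
      ∑ a, sectional x (stdOrthonormalBasis ℝ V a : TangentSpace 𝓘(ℝ, E) x) Y
        = ∑ i, sectional x (b i : TangentSpace 𝓘(ℝ, E) x) Y := by
    intro Y
    exact sum_bilin_orthonormalBasis (LinearMap.mk₂ ℝ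
      (fun X X' : V ↦ ⟪curvature x (X : TangentSpace 𝓘(ℝ, E) x) Y Y, X'⟫_ℝ)
      (by intro X X' Z; rw [← inner_add_left]; congr 1
          simp only [curvature, localCurvature, ← map_add]; congr 1
          simp; abel)
      (by intro r X Z; rw [smul_eq_mul, ← real_inner_smul_left]; congr 1
          simp only [curvature, localCurvature, ← map_smul]; congr 1
          simp [smul_sub, smul_add])
      (by intro X Z Z'; simp [inner_add_right])
      (by intro r X Z; simp [real_inner_smul_right])) _ b
  have hW : ∀ X : TangentSpace 𝓘(ℝ, E) x,
      ∑ a, sectional x X (stdOrthonormalBasis ℝ W a : TangentSpace 𝓘(ℝ, E) x)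
        = ∑ i, sectional x X (c i : TangentSpace 𝓘(ℝ, E) x) := by
    intro X
    exact sum_bilin_orthonormalBasis (LinearMap.mk₂ ℝ
      (fun Y Y' : W ↦ ⟪curvature x X (Y : TangentSpace 𝓘(ℝ, E) x)
        (Y' : TangentSpace 𝓘(ℝ, E) x), X⟫_ℝ)
      (by intro Y Y' Z; rw [← inner_add_left]; congr 1
          simp only [curvature, localCurvature, ← map_add]; congr 1
          simp; abel)
      (by intro r Y Z; rw [smul_eq_mul, ← real_inner_smul_left]; congr 1
          simp only [curvature, localCurvature, ← map_smul]; congr 1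
          simp [smul_sub, smul_add])
      (by intro Y Z Z'; rw [← inner_add_left]; congr 1
          simp only [curvature, localCurvature, ← map_add]; congr 1
          simp; abel)
      (by intro r Y Z; rw [smul_eq_mul, ← real_inner_smul_left]; congr 1
          simp only [curvature, localCurvature, ← map_smul]; congr 1
          simp [smul_sub, smul_add])) _ c
  unfold mixedScalarPair
  rw [Finset.sum_comm]
  simp only [hV]
  rw [Finset.sum_comm]
  simp only [hW]

end Manifold

/-! ### Almost `k`-product structures -/

section Structures

variable {E : Type*} [NormedAddCommGroup E] [NormedSpace ℝ E]
  {M : Type*} [TopologicalSpace M] [ChartedSpace E M] [IsManifold 𝓘(ℝ, E) ∞ M]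

/-- A smooth distribution (subbundle of the tangent bundle) of rank `r`: a field of
`r`-dimensional subspaces which is locally spanned by `r` smooth vector fields. -/
structure IsDistribution (r : ℕ) (D : (x : M) → Submodule ℝ (TangentSpace 𝓘(ℝ, E) x)) : Prop where
  finrank_eq : ∀ x, Module.finrank ℝ (D x) = r
  exists_frame : ∀ x, ∃ U ∈ 𝓝 x, ∃ X : Fin r → (y : M) → TangentSpace 𝓘(ℝ, E) y,
    (∀ a, ContMDiffOn 𝓘(ℝ, E) (𝓘(ℝ, E).prod 𝓘(ℝ, E)) ∞
      (fun y ↦ (⟨y, X a y⟩ : TangentBundle 𝓘(ℝ, E) M)) U) ∧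
    ∀ y ∈ U, D y = Submodule.span ℝ (Set.range fun a ↦ X a y)

variable [RiemannianBundle (fun x : M ↦ TangentSpace 𝓘(ℝ, E) x)]

/-- `D_1, …, D_k` are complementary, pairwise orthogonal smooth distributions of ranks
`n_1, …, n_k` on the Riemannian manifold `M`: a Riemannian almost `k`-product structure. -/
structure IsAlmostProduct {k : ℕ} (n : Fin k → ℕ)
    (D : Fin k → (x : M) → Submodule ℝ (TangentSpace 𝓘(ℝ, E) x)) : Prop where
  isDistribution : ∀ i, IsDistribution (n i) (D i)
  orthogonal : ∀ i j, i ≠ j → ∀ x, D i x ⟂ D j x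
  complementary : ∀ x, ⨆ i, D i x = ⊤

/-- The invariant `δ̂_mix(n_1, …, n_k)`: the supremum of `S_mix(V_1, …, V_k)` over all points `x`
and all subspaces `V_i ⊆ D_i(x)` with `dim V_i = n_i`. It may be infinite. -/
def deltaHat [FiniteDimensional ℝ E] {k : ℕ}
    (D : Fin k → (x : M) → Submodule ℝ (TangentSpace 𝓘(ℝ, E) x)) (n : Fin k → ℕ) : EReal :=
  ⨆ (x : M) (V : Fin k → Submodule ℝ (TangentSpace 𝓘(ℝ, E) x))
    (_ : ∀ i, V i ≤ D i x ∧ Module.finrank ℝ (V i) = n i), ((mixedScalar x V : ℝ) : EReal)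

end Structures

/-! ### Isometric immersions -/

section Immersions

variable {E : Type*} [NormedAddCommGroup E] [NormedSpace ℝ E]
  {M : Type*} [TopologicalSpace M] [ChartedSpace E M] [IsManifold 𝓘(ℝ, E) ∞ M]
  [RiemannianBundle (fun x : M ↦ TangentSpace 𝓘(ℝ, E) x)]
  {F : Type*} [NormedAddCommGroup F] [NormedSpace ℝ F]
  {N : Type*} [TopologicalSpace N] [ChartedSpace F N] [IsManifold 𝓘(ℝ, F) ∞ N]
  [RiemannianBundle (fun x : N ↦ TangentSpace 𝓘(ℝ, F) x)]

variable (E F) in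
/-- A smooth isometric immersion. (The differential is injective since it preserves inner
products.) -/
structure IsIsometricImmersion (f : M → N) : Prop where
  contMDiff : ContMDiff 𝓘(ℝ, E) 𝓘(ℝ, F) ∞ f
  inner_eq : ∀ (x : M) (X Y : TangentSpace 𝓘(ℝ, E) x),
    ⟪mfderiv 𝓘(ℝ, E) 𝓘(ℝ, F) f x X, mfderiv 𝓘(ℝ, E) 𝓘(ℝ, F) f x Y⟫_ℝ = ⟪X, Y⟫_ℝ

variable (F) in
/-- The ambient covariant derivative `∇̄_X (f_* Y)` at `x`, where `X` and `Y` are extended with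
constant coordinates in the preferred chart at `x`: with `φ` the coordinate expression of `f`, it is
`D²φ(X, Y) + Γ̄(Dφ X, Dφ Y)`. -/
def ambientDeriv (f : M → N) (x : M) (X Y : TangentSpace 𝓘(ℝ, E) x) :
    TangentSpace 𝓘(ℝ, F) (f x) :=
  let φ : E → F := writtenInExtChartAt 𝓘(ℝ, E) 𝓘(ℝ, F) x f
  let y : E := extChartAt 𝓘(ℝ, E) x x
  let u : E := toCoord x x X
  let v : E := toCoord x x Y
  ofCoord (f x) (f x) (fderiv ℝ (fderiv ℝ φ) y u v
    + christoffel (chartMetric (f x)) (φ y) (fderiv ℝ φ y u) (fderiv ℝ φ y v))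

variable [FiniteDimensional ℝ F]

variable (F) in
/-- The second fundamental form `h̄(X, Y)` of `f` at `x`: the component of `∇̄_X (f_* Y)` normal to
`f_* (T_x M)`. -/
def secondFundamentalForm (f : M → N) (x : M) (X Y : TangentSpace 𝓘(ℝ, E) x) :
    TangentSpace 𝓘(ℝ, F) (f x) :=
  ((mfderiv 𝓘(ℝ, E) 𝓘(ℝ, F) f x : TangentSpace 𝓘(ℝ, E) x →ₗ[ℝ]
    TangentSpace 𝓘(ℝ, F) (f x)).range)ᗮ.starProjection (ambientDeriv F f x X Y)

variable (F) in
/-- `h̄(X, Y) = 0` at `x` for all `X ∈ D_i(x)`, `Y ∈ D_j(x)`, `i ≠ j`. -/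
def IsMixedTotallyGeodesicAt {k : ℕ} (f : M → N)
    (D : Fin k → (x : M) → Submodule ℝ (TangentSpace 𝓘(ℝ, E) x)) (x : M) : Prop :=
  ∀ i j, i ≠ j → ∀ X ∈ D i x, ∀ Y ∈ D j x, secondFundamentalForm F f x X Y = 0

variable (F) in
/-- `f` is mixed totally geodesic. -/
def IsMixedTotallyGeodesic {k : ℕ} (f : M → N)
    (D : Fin k → (x : M) → Submodule ℝ (TangentSpace 𝓘(ℝ, E) x)) : Prop :=
  ∀ x, IsMixedTotallyGeodesicAt F f D x

/-- The differential of `f` maps each `D_i` into `D̄_i`. -/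
def IsAdapted {k : ℕ} (f : M → N)
    (D : Fin k → (x : M) → Submodule ℝ (TangentSpace 𝓘(ℝ, E) x))
    (D' : Fin k → (x : N) → Submodule ℝ (TangentSpace 𝓘(ℝ, F) x)) : Prop :=
  ∀ i x, ∀ X ∈ D i x, mfderiv 𝓘(ℝ, E) 𝓘(ℝ, F) f x X ∈ D' i (f x)

variable [FiniteDimensional ℝ E]

variable (F) in
/-- The mean curvature vector `∑_a h̄(e_a, e_a)` of a subspace `V` of `T_x M`, the (unnormalized)
trace over an orthonormal basis of `V`. -/
def partialMeanCurvature (f : M → N) (x : M) (V : Submodule ℝ (TangentSpace 𝓘(ℝ, E) x)) :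
    TangentSpace 𝓘(ℝ, F) (f x) :=
  ∑ a, secondFundamentalForm F f x (stdOrthonormalBasis ℝ V a : TangentSpace 𝓘(ℝ, E) x)
    (stdOrthonormalBasis ℝ V a : TangentSpace 𝓘(ℝ, E) x)

variable (E F) in
/-- The mean curvature vector `H̄ = tr h̄` of `f` at `x` (not divided by the dimension). -/
def meanCurvature (f : M → N) (x : M) : TangentSpace 𝓘(ℝ, F) (f x) :=
  partialMeanCurvature F f x (⊤ : Submodule ℝ (TangentSpace 𝓘(ℝ, E) x))

variable (F) in
/-- The image subspace `f_* V` of a subspace `V` of `T_x M`. -/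
def pushforward (f : M → N) (x : M) (V : Submodule ℝ (TangentSpace 𝓘(ℝ, E) x)) :
    Submodule ℝ (TangentSpace 𝓘(ℝ, F) (f x)) :=
  V.map (mfderiv 𝓘(ℝ, E) 𝓘(ℝ, F) f x : TangentSpace 𝓘(ℝ, E) x →ₗ[ℝ] TangentSpace 𝓘(ℝ, F) (f x))

end Immersions

end AlmostProduct

end

/-!
The proof rests on the Gauss equation: the mixed scalar curvature of `M` differs from that of the
subspaces `f_* D_i` in the ambient manifold only through the second fundamental form `h`,

  `S_mix(D_1, …, D_k) = S_mix(f_* D_1, …, f_* D_k) + ∑_{i<j} ⟨H_i, H_j⟩ - ∑_{i<j} ‖h|_{D_i × D_j}‖²`,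

where `H_i` is the trace of `h` over `D_i`. As the `D_i` are complementary and orthogonal,
`H = ∑ H_i`, and the polarization identity

  `∑_{i<j} ⟨H_i, H_j⟩ = (k - 1) / (2 k) ‖H‖² - 1 / (2 k) ∑_{i<j} ‖H_i - H_j‖²`

(`sum_inner_lt_eq`) turns this into `S_mix + defect = S_mix(f_* D) + (k - 1) / (2 k) ‖H‖²`
(`IsIsometricImmersion.mixedScalar_add_mixedDefect`), where the defect is a sum of squares. It
vanishes exactly when `h` has no mixed part and all `H_i` agree, and `S_mix(f_* D)` is one of the
competitors in the supremum `δ̂_mix`; the inequality and its equality cases follow.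

The Gauss equation is proved in charts. For an isometric map `φ` between metrics on open sets of
vector spaces, the Koszul formula shows that the tangential part of `∇_u (Dφ v)` is
`Dφ (∇_u v)` (`IsLocalIsometry.inner_covDerivImage`). Differentiating this identity once more,
antisymmetrizing, and using that the covariant derivatives along `φ` commute up to the curvature of
the target (`covDerivImage_commutator`) gives the result (`IsLocalIsometry.gauss`). A Riemannian
metric read in a chart is a smooth metric, and an isometric immersion read in charts is an isometric
map in this sense (`IsIsometricImmersion.isLocalIsometry`), which transfers the equation to
manifolds (`IsIsometricImmersion.sectional_eq`).
-/

namespace AlmostProduct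

/-! ### The Gauss equation for metrics on open sets of vector spaces -/

section LocalGauss

variable {E : Type*} [NormedAddCommGroup E] [NormedSpace ℝ E]
  {F : Type*} [NormedAddCommGroup F] [NormedSpace ℝ F]

/-- Product rule for a varying bilinear map evaluated on two varying vectors. -/
theorem fderiv_bilin_apply {P Q R : Type*} [NormedAddCommGroup P] [NormedSpace ℝ P]
    [NormedAddCommGroup Q] [NormedSpace ℝ Q] [NormedAddCommGroup R] [NormedSpace ℝ R]
    {B : E → P →L[ℝ] Q →L[ℝ] R} {a : E → P} {b : E → Q} {y : E}
    (hB : DifferentiableAt ℝ B y) (ha : DifferentiableAt ℝ a y) (hb : DifferentiableAt ℝ b y)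
    (u : E) :
    fderiv ℝ (fun z ↦ B z (a z) (b z)) y u =
      fderiv ℝ B y u (a y) (b y) + B y (fderiv ℝ a y u) (b y) + B y (a y) (fderiv ℝ b y u) := by
  rw [((hB.hasFDerivAt.clm_apply ha.hasFDerivAt).clm_apply hb.hasFDerivAt).fderiv]
  simp [add_comm]

/-- A smooth Riemannian metric on the open set `U` of the vector space `E`. -/
structure IsMetricOn (G : E → E →L[ℝ] E →L[ℝ] ℝ) (U : Set E) : Prop where
  isOpen : IsOpen U
  contDiffOn : ContDiffOn ℝ ∞ G U
  symm : ∀ y ∈ U, ∀ u v, G y u v = G y v u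
  pos : ∀ y ∈ U, ∀ u, u ≠ 0 → 0 < G y u u

namespace IsMetricOn

variable {G : E → E →L[ℝ] E →L[ℝ] ℝ} {U : Set E} {y : E}

theorem contDiffAt (h : IsMetricOn G U) (hy : y ∈ U) : ContDiffAt ℝ ∞ G y :=
  h.contDiffOn.contDiffAt (h.isOpen.mem_nhds hy)

theorem differentiableAt (h : IsMetricOn G U) (hy : y ∈ U) : DifferentiableAt ℝ G y :=
  (h.contDiffAt hy).differentiableAt (by simp)

theorem fderiv_symm (h : IsMetricOn G U) (hy : y ∈ U) (u v w : E) :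
    fderiv ℝ G y u v w = fderiv ℝ G y u w v := by
  have key : ∀ v w : E, fderiv ℝ (fun z ↦ G z v w) y u = fderiv ℝ G y u v w := fun v w ↦ by
    rw [fderiv_bilin_apply (h.differentiableAt hy) (differentiableAt_const v)
      (differentiableAt_const w)]
    simp
  rw [← key v w, ← key w v]
  congr 1
  refine Filter.EventuallyEq.fderiv_eq ?_
  filter_upwards [h.isOpen.mem_nhds hy] with z hz using h.symm z hz v w

theorem ext_of_forall (h : IsMetricOn G U) (hy : y ∈ U) {u v : E}
    (huv : ∀ w, G y u w = G y v w) : u = v := by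
  by_contra hne
  have := h.pos y hy (u - v) (sub_ne_zero.2 hne)
  rw [(G y).map_sub, sub_apply, huv, sub_self] at this
  exact this.false

variable [FiniteDimensional ℝ E]

theorem exists_equiv (h : IsMetricOn G U) (hy : y ∈ U) :
    ∃ e : E ≃L[ℝ] (E →L[ℝ] ℝ), (e : E →L[ℝ] E →L[ℝ] ℝ) = G y := by
  have hinj : Function.Injective (G y : E →ₗ[ℝ] E →L[ℝ] ℝ) := fun u v huv ↦
    h.ext_of_forall hy fun w ↦ DFunLike.congr_fun huv w
  have hrank : Module.finrank ℝ E = Module.finrank ℝ (E →L[ℝ] ℝ) := by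
    rw [← (LinearMap.toContinuousLinearMap (𝕜 := ℝ) (E := E) (F' := ℝ)).finrank_eq]
    exact Subspace.dual_finrank_eq.symm
  refine ⟨(LinearEquiv.ofInjectiveOfFinrankEq _ hinj hrank).toContinuousLinearEquiv, ?_⟩
  ext u v
  exact congrArg (fun T : E →ₗ[ℝ] E →L[ℝ] ℝ ↦ T u v)
    (LinearEquiv.coe_ofInjectiveOfFinrankEq _ hinj hrank)

/-- The Koszul formula. -/
theorem apply_christoffel (h : IsMetricOn G U) (hy : y ∈ U) (u v w : E) :
    G y (christoffel G y u v) w = koszul G y u v w := by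
  obtain ⟨e, he⟩ := h.exists_equiv hy
  have : christoffel G y u v = e.symm (koszul G y u v) := by
    simp [christoffel, ← he]
  rw [this, ← he]
  simp

theorem christoffel_symm (h : IsMetricOn G U) (hy : y ∈ U) (u v : E) :
    christoffel G y u v = christoffel G y v u := by
  refine h.ext_of_forall hy fun w ↦ ?_
  simp only [h.apply_christoffel hy, koszul_apply, h.fderiv_symm hy w u v]
  ring

/-- The Levi-Civita connection is metric. -/
theorem fderiv_eq (h : IsMetricOn G U) (hy : y ∈ U) (u v w : E) :
    fderiv ℝ G y u v w = G y (christoffel G y u v) w + G y v (christoffel G y u w) := by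
  rw [h.symm y hy v]
  simp only [h.apply_christoffel hy, koszul_apply, h.fderiv_symm hy u w v,
    h.fderiv_symm hy v u w]
  ring

theorem differentiableAt_christoffel (h : IsMetricOn G U) (hy : y ∈ U) :
    DifferentiableAt ℝ (christoffel G) y := by
  have hG' : DifferentiableAt ℝ (fderiv ℝ G) y :=
    ((h.contDiffAt hy).fderiv_right (m := 1) (by decide)).differentiableAt (by simp)
  obtain ⟨e, he⟩ := h.exists_equiv hy
  have hinv : DifferentiableAt ℝ (fun z ↦ (G z).inverse) y := by
    have h1 : ContDiffAt ℝ 1 ContinuousLinearMap.inverse (G y) := by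
      rw [← he]; exact contDiffAt_map_inverse e
    exact (h1.differentiableAt (by simp)).comp y (h.differentiableAt hy)
  have hflip : DifferentiableAt ℝ (fun z ↦ (fderiv ℝ G z).flip) y :=
    (ContinuousLinearMap.flipₗᵢ ℝ E E (E →L[ℝ] ℝ)).toContinuousLinearEquiv.differentiableAt.comp
      y hG'
  have hkos : DifferentiableAt ℝ (koszul G) y := by
    refine ((hG'.add hflip).sub ?_).const_smul (1 / 2 : ℝ)
    exact (differentiableAt_const _).clm_comp hflip
  exact ((ContinuousLinearMap.compL ℝ E (E →L[ℝ] ℝ) E).differentiableAt.comp y hinv).clm_comp hkos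

/-- The Levi-Civita connection is metric along a map `φ`: for vector fields `a`, `b` along `φ`,
the derivative of `⟨a, b⟩` is `⟨∇ a, b⟩ + ⟨a, ∇ b⟩`. -/
theorem fderiv_along {X : Type*} [NormedAddCommGroup X] [NormedSpace ℝ X]
    (h : IsMetricOn G U) {φ a b : X → E} {x : X} (hx : φ x ∈ U)
    (hφ : DifferentiableAt ℝ φ x) (ha : DifferentiableAt ℝ a x) (hb : DifferentiableAt ℝ b x)
    (u : X) :
    fderiv ℝ (fun z ↦ G (φ z) (a z) (b z)) x u =
      G (φ x) (fderiv ℝ a x u + christoffel G (φ x) (fderiv ℝ φ x u) (a x)) (b x) +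
      G (φ x) (a x) (fderiv ℝ b x u + christoffel G (φ x) (fderiv ℝ φ x u) (b x)) := by
  have hG := h.differentiableAt hx
  rw [fderiv_bilin_apply (B := fun z ↦ G (φ z)) (hG.comp x hφ) ha hb]
  have : fderiv ℝ (fun z ↦ G (φ z)) x u = fderiv ℝ G (φ x) (fderiv ℝ φ x u) := by
    rw [fderiv_fun_comp x hG hφ]; rfl
  rw [this, h.fderiv_eq hx]
  simp only [map_add, add_apply]
  ring

end IsMetricOn

/-- The covariant derivative `∇_u (Dφ v) = D²φ (u, v) + Γ (Dφ u, Dφ v)` of the image of a constant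
vector field under a map `φ` into a space with Christoffel symbols `Γ`. -/
noncomputable def covDerivImage (Γ : F → F →L[ℝ] F →L[ℝ] F) (φ : E → F) (z u v : E) : F :=
  fderiv ℝ (fderiv ℝ φ) z u v + Γ (φ z) (fderiv ℝ φ z u) (fderiv ℝ φ z v)

section Map

variable {φ : E → F} {U : Set E} {y : E}

theorem _root_.ContDiffAt.fderiv_infty (hφ : ContDiffAt ℝ ∞ φ y) :
    ContDiffAt ℝ ∞ (fderiv ℝ φ) y :=
  hφ.fderiv_right (by decide)

theorem _root_.ContDiffAt.fderiv_fderiv_symm (hφ : ContDiffAt ℝ ∞ φ y) (u v : E) :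
    fderiv ℝ (fderiv ℝ φ) y u v = fderiv ℝ (fderiv ℝ φ) y v u :=
  hφ.isSymmSndFDerivAt (by simp; decide) u v

theorem differentiableAt_covDerivImage {Γ : F → F →L[ℝ] F →L[ℝ] F} (hφ : ContDiffAt ℝ ∞ φ y)
    (hΓ : DifferentiableAt ℝ Γ (φ y)) (v w : E) :
    DifferentiableAt ℝ (fun z ↦ covDerivImage Γ φ z v w) y := by
  have h1 : DifferentiableAt ℝ φ y := hφ.differentiableAt (by simp)
  have h2 : DifferentiableAt ℝ (fderiv ℝ φ) y := hφ.fderiv_infty.differentiableAt (by simp)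
  have h3 : DifferentiableAt ℝ (fderiv ℝ (fderiv ℝ φ)) y :=
    hφ.fderiv_infty.fderiv_infty.differentiableAt (by simp)
  have h4 : DifferentiableAt ℝ (fun z ↦ Γ (φ z)) y := hΓ.comp y h1
  unfold covDerivImage
  fun_prop

theorem fderiv_covDerivImage {Γ : F → F →L[ℝ] F →L[ℝ] F} (hφ : ContDiffAt ℝ ∞ φ y)
    (hΓ : DifferentiableAt ℝ Γ (φ y)) (u v w : E) :
    fderiv ℝ (fun z ↦ covDerivImage Γ φ z v w) y u =
      fderiv ℝ (fderiv ℝ (fderiv ℝ φ)) y u v w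
      + fderiv ℝ Γ (φ y) (fderiv ℝ φ y u) (fderiv ℝ φ y v) (fderiv ℝ φ y w)
      + Γ (φ y) (fderiv ℝ (fderiv ℝ φ) y u v) (fderiv ℝ φ y w)
      + Γ (φ y) (fderiv ℝ φ y v) (fderiv ℝ (fderiv ℝ φ) y u w) := by
  have h1 : DifferentiableAt ℝ φ y := hφ.differentiableAt (by simp)
  have h2 : DifferentiableAt ℝ (fderiv ℝ φ) y := hφ.fderiv_infty.differentiableAt (by simp)
  have h3 : DifferentiableAt ℝ (fderiv ℝ (fderiv ℝ φ)) y :=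
    hφ.fderiv_infty.fderiv_infty.differentiableAt (by simp)
  have h4 : DifferentiableAt ℝ (fun z ↦ Γ (φ z)) y := hΓ.comp y h1
  have h5 (v : E) : DifferentiableAt ℝ (fun z ↦ fderiv ℝ φ z v) y := by fun_prop
  have h6 (v : E) : fderiv ℝ (fun z ↦ fderiv ℝ φ z v) y u = fderiv ℝ (fderiv ℝ φ) y u v := by
    rw [fderiv_clm_apply h2 (differentiableAt_const v)]; simp
  have h7 : fderiv ℝ (fun z ↦ Γ (φ z)) y u = fderiv ℝ Γ (φ y) (fderiv ℝ φ y u) := by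
    rw [fderiv_fun_comp y hΓ h1]; rfl
  have h8 : DifferentiableAt ℝ (fun z ↦ fderiv ℝ (fderiv ℝ φ) z v w) y := by fun_prop
  have h9 : DifferentiableAt ℝ
      (fun z ↦ Γ (φ z) (fderiv ℝ φ z v) (fderiv ℝ φ z w)) y := by fun_prop
  unfold covDerivImage
  rw [fderiv_fun_add h8 h9, add_apply,
    fderiv_bilin_apply h3 (differentiableAt_const v) (differentiableAt_const w),
    fderiv_bilin_apply h4 (h5 v) (h5 w), h6, h6, h7]
  simp [add_assoc]

variable {G' : F → F →L[ℝ] F →L[ℝ] ℝ} {V : Set F}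

variable {G : E → E →L[ℝ] E →L[ℝ] ℝ}

/-- `φ` is a smooth map from `U` to `V` with `φ^* G' = G`, for smooth metrics `G` on `U` and `G'` on
`V`. The dimensions may differ: `φ` is an isometric immersion of open sets of vector spaces. -/
structure IsLocalIsometry (G : E → E →L[ℝ] E →L[ℝ] ℝ) (U : Set E)
    (G' : F → F →L[ℝ] F →L[ℝ] ℝ) (V : Set F) (φ : E → F) : Prop where
  source : IsMetricOn G U
  target : IsMetricOn G' V
  mapsTo : Set.MapsTo φ U V
  contDiffOn : ContDiffOn ℝ ∞ φ U
  isometry : ∀ y ∈ U, ∀ u v, G' (φ y) (fderiv ℝ φ y u) (fderiv ℝ φ y v) = G y u v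

namespace IsLocalIsometry

theorem contDiffAt (h : IsLocalIsometry G U G' V φ) (hy : y ∈ U) : ContDiffAt ℝ ∞ φ y :=
  h.contDiffOn.contDiffAt (h.source.isOpen.mem_nhds hy)

end IsLocalIsometry

variable [FiniteDimensional ℝ F]

theorem covDerivImage_symm (h' : IsMetricOn G' V) (hφ : ContDiffAt ℝ ∞ φ y) (hy : φ y ∈ V)
    (u v : E) :
    covDerivImage (christoffel G') φ y u v = covDerivImage (christoffel G') φ y v u := by
  simp only [covDerivImage, hφ.fderiv_fderiv_symm u v, h'.christoffel_symm hy (fderiv ℝ φ y u)]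

/-- The commutator of the covariant derivatives along a map is the curvature of the target. -/
theorem covDerivImage_commutator (h' : IsMetricOn G' V) (hφ : ContDiffAt ℝ ∞ φ y)
    (hy : φ y ∈ V) (u v w : E) :
    (fderiv ℝ (fun z ↦ covDerivImage (christoffel G') φ z v w) y u
      + christoffel G' (φ y) (fderiv ℝ φ y u) (covDerivImage (christoffel G') φ y v w))
    - (fderiv ℝ (fun z ↦ covDerivImage (christoffel G') φ z u w) y v
      + christoffel G' (φ y) (fderiv ℝ φ y v) (covDerivImage (christoffel G') φ y u w)) =
    localCurvature G' (φ y) (fderiv ℝ φ y u) (fderiv ℝ φ y v) (fderiv ℝ φ y w) := by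
  have hΓ := h'.differentiableAt_christoffel hy
  -- the third derivatives of `φ` and the terms `Γ (D²φ, Dφ)` cancel by symmetry
  rw [fderiv_covDerivImage hφ hΓ, fderiv_covDerivImage hφ hΓ,
    hφ.fderiv_infty.fderiv_fderiv_symm u v, hφ.fderiv_fderiv_symm u v]
  simp only [covDerivImage, localCurvature, map_add]
  abel

variable [FiniteDimensional ℝ E]

namespace IsLocalIsometry

/-- The tangential part of `∇_u (Dφ v)` is the image of `∇_u v`. -/
theorem inner_covDerivImage (h : IsLocalIsometry G U G' V φ) (hy : y ∈ U) (u v w : E) :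
    G' (φ y) (covDerivImage (christoffel G') φ y u v) (fderiv ℝ φ y w) =
      G y (christoffel G y u v) w := by
  have hφ := h.contDiffAt hy
  have h1 : DifferentiableAt ℝ φ y := hφ.differentiableAt (by simp)
  have h2 : DifferentiableAt ℝ (fderiv ℝ φ) y := hφ.fderiv_infty.differentiableAt (by simp)
  have h5 (v : E) : DifferentiableAt ℝ (fun z ↦ fderiv ℝ φ z v) y := by fun_prop
  have h6 (u v : E) : fderiv ℝ (fun z ↦ fderiv ℝ φ z v) y u = fderiv ℝ (fderiv ℝ φ) y u v := by
    rw [fderiv_clm_apply h2 (differentiableAt_const v)]; simp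
  -- the derivative of the identity `G = φ^* G'`; the Koszul formula then solves for `∇_u (Dφ v)`
  have key (u v w : E) : fderiv ℝ G y u v w =
      G' (φ y) (covDerivImage (christoffel G') φ y u v) (fderiv ℝ φ y w) +
      G' (φ y) (covDerivImage (christoffel G') φ y u w) (fderiv ℝ φ y v) := by
    rw [h.target.symm _ (h.mapsTo hy) _ (fderiv ℝ φ y v)]
    have := h.target.fderiv_along (h.mapsTo hy) h1 (h5 v) (h5 w) u
    rw [h6, h6] at this
    rw [covDerivImage, covDerivImage, ← this]
    have e : (fun z ↦ G' (φ z) (fderiv ℝ φ z v) (fderiv ℝ φ z w)) =ᶠ[𝓝 y] fun z ↦ G z v w := by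
      filter_upwards [h.source.isOpen.mem_nhds hy] with z hz using h.isometry z hz v w
    rw [e.fderiv_eq, fderiv_bilin_apply (h.source.differentiableAt hy) (differentiableAt_const v)
      (differentiableAt_const w)]
    simp
  rw [h.source.apply_christoffel hy, koszul_apply, key, key, key,
    covDerivImage_symm h.target hφ (h.mapsTo hy) v u,
    covDerivImage_symm h.target hφ (h.mapsTo hy) w u,
    covDerivImage_symm h.target hφ (h.mapsTo hy) w v]
  ring

/-- The second fundamental form `∇_u (Dφ v) - Dφ (∇_u v)` of a local isometry. -/
noncomputable def secondForm (G : E → E →L[ℝ] E →L[ℝ] ℝ) (G' : F → F →L[ℝ] F →L[ℝ] ℝ)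
    (φ : E → F) (y u v : E) : F :=
  covDerivImage (christoffel G') φ y u v - fderiv ℝ φ y (christoffel G y u v)

theorem inner_secondForm (h : IsLocalIsometry G U G' V φ) (hy : y ∈ U) (u v w : E) :
    G' (φ y) (secondForm G G' φ y u v) (fderiv ℝ φ y w) = 0 := by
  rw [secondForm, map_sub, sub_apply, h.inner_covDerivImage hy,
    h.isometry y hy, sub_self]

theorem inner_covDerivImage_covDerivImage (h : IsLocalIsometry G U G' V φ) (hy : y ∈ U)
    (u v w z : E) :
    G' (φ y) (covDerivImage (christoffel G') φ y u v) (covDerivImage (christoffel G') φ y w z) =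
      G y (christoffel G y u v) (christoffel G y w z) +
      G' (φ y) (secondForm G G' φ y u v) (secondForm G G' φ y w z) := by
  have h1 := h.inner_covDerivImage hy u v (christoffel G y w z)
  have h2 := h.inner_covDerivImage hy w z (christoffel G y u v)
  rw [h.target.symm _ (h.mapsTo hy)] at h2
  have h3 := h.isometry y hy (christoffel G y u v) (christoffel G y w z)
  have h4 := h.source.symm y hy (christoffel G y u v) (christoffel G y w z)
  simp only [secondForm, map_sub, sub_apply]
  linarith

/-- The Gauss equation for `⟨∇_u ∇_v w, z⟩`, before antisymmetrization in `u`, `v`: the derivative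
in the direction `u` of the identity `⟨∇_v (Dφ w), Dφ z⟩ = ⟨∇_v w, z⟩`. -/
theorem inner_fderiv_covDerivImage (h : IsLocalIsometry G U G' V φ) (hy : y ∈ U) (u v w z : E) :
    G' (φ y) (fderiv ℝ (fun x ↦ covDerivImage (christoffel G') φ x v w) y u
      + christoffel G' (φ y) (fderiv ℝ φ y u) (covDerivImage (christoffel G') φ y v w))
      (fderiv ℝ φ y z)
      + G' (φ y) (secondForm G G' φ y v w) (secondForm G G' φ y u z) =
    G y (fderiv ℝ (christoffel G) y u v w + christoffel G y u (christoffel G y v w)) z := by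
  have hφ := h.contDiffAt hy
  have hΓ := h.source.differentiableAt_christoffel hy
  have h1 : DifferentiableAt ℝ φ y := hφ.differentiableAt (by simp)
  have h2 : DifferentiableAt ℝ (fderiv ℝ φ) y := hφ.fderiv_infty.differentiableAt (by simp)
  have h5 : DifferentiableAt ℝ (fun x ↦ fderiv ℝ φ x z) y := by fun_prop
  have h6 : fderiv ℝ (fun x ↦ fderiv ℝ φ x z) y u = fderiv ℝ (fderiv ℝ φ) y u z := by
    rw [fderiv_clm_apply h2 (differentiableAt_const z)]; simp
  have h7 : DifferentiableAt ℝ (fun x ↦ christoffel G x v w) y := by fun_prop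
  have h8 : fderiv ℝ (fun x ↦ christoffel G x v w) y u = fderiv ℝ (christoffel G) y u v w := by
    rw [fderiv_bilin_apply hΓ (differentiableAt_const v) (differentiableAt_const w)]; simp
  have hA := h.target.fderiv_along (h.mapsTo hy) h1
    (differentiableAt_covDerivImage hφ (h.target.differentiableAt_christoffel (h.mapsTo hy)) v w)
    h5 u
  have hB := h.source.fderiv_along (φ := id) hy differentiableAt_id h7
    (differentiableAt_const z) u
  have e : (fun x ↦ G' (φ x) (covDerivImage (christoffel G') φ x v w) (fderiv ℝ φ x z)) =ᶠ[𝓝 y]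
      fun x ↦ G (id x) (christoffel G x v w) z := by
    filter_upwards [h.source.isOpen.mem_nhds hy] with x hx using h.inner_covDerivImage hx v w z
  rw [e.fderiv_eq, hB, h6, h8] at hA
  have hC := h.inner_covDerivImage_covDerivImage hy v w u z
  simp only [covDerivImage.eq_1 _ _ _ u z] at hC
  simp only [fderiv_id, id, ContinuousLinearMap.id_apply, fderiv_fun_const, Pi.zero_apply,
    zero_apply, zero_add] at hA
  linarith

/-- The Gauss equation, in the convention `R (u, v) w = ∇_u ∇_v w - ∇_v ∇_u w`. -/
theorem gauss (h : IsLocalIsometry G U G' V φ) (hy : y ∈ U) (u v w z : E) :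
    G y (localCurvature G y u v w) z =
      G' (φ y) (localCurvature G' (φ y) (fderiv ℝ φ y u) (fderiv ℝ φ y v) (fderiv ℝ φ y w))
        (fderiv ℝ φ y z)
      + G' (φ y) (secondForm G G' φ y v w) (secondForm G G' φ y u z)
      - G' (φ y) (secondForm G G' φ y u w) (secondForm G G' φ y v z) := by
  have h1 := h.inner_fderiv_covDerivImage hy u v w z
  have h2 := h.inner_fderiv_covDerivImage hy v u w z
  rw [← covDerivImage_commutator h.target (h.contDiffAt hy) (h.mapsTo hy), map_sub,
    sub_apply]
  simp only [localCurvature, map_sub, map_add, sub_apply,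
    add_apply] at h1 h2 ⊢
  linarith

end IsLocalIsometry

end Map

end LocalGauss

/-! ### The Gauss equation of an isometric immersion -/

section Chart

variable {E : Type*} [NormedAddCommGroup E] [NormedSpace ℝ E]
  {M : Type*} [TopologicalSpace M] [ChartedSpace E M] [IsManifold 𝓘(ℝ, E) ∞ M]

theorem mem_baseSet_of_mem_source {p x : M} (hx : x ∈ (extChartAt 𝓘(ℝ, E) p).source) :
    x ∈ (trivializationAt E (TangentSpace 𝓘(ℝ, E) : M → Type _) p).baseSet := by
  simpa using hx

theorem toCoord_ofCoord {p x : M} (hx : x ∈ (extChartAt 𝓘(ℝ, E) p).source) (u : E) :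
    toCoord p x (ofCoord p x u) = u :=
  Trivialization.continuousLinearMapAt_symmL _ (mem_baseSet_of_mem_source hx) u

theorem ofCoord_toCoord {p x : M} (hx : x ∈ (extChartAt 𝓘(ℝ, E) p).source)
    (X : TangentSpace 𝓘(ℝ, E) x) : ofCoord p x (toCoord p x X) = X :=
  Trivialization.symmL_continuousLinearMapAt _ (mem_baseSet_of_mem_source hx) X

section Metric

variable [RiemannianBundle (fun x : M ↦ TangentSpace 𝓘(ℝ, E) x)]

theorem chartMetric_apply (p : M) (y u v : E) :
    chartMetric p y u v = ⟪ofCoord p ((extChartAt 𝓘(ℝ, E) p).symm y) u,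
      ofCoord p ((extChartAt 𝓘(ℝ, E) p).symm y) v⟫_ℝ := rfl

theorem chartMetric_extChartAt {p x : M} (hx : x ∈ (extChartAt 𝓘(ℝ, E) p).source) (u v : E) :
    chartMetric p (extChartAt 𝓘(ℝ, E) p x) u v = ⟪ofCoord p x u, ofCoord p x v⟫_ℝ := by
  -- the tangent space depends on the base point, so the base point is generalized
  have : ∀ z, z = x → ⟪ofCoord p z u, ofCoord p z v⟫_ℝ = ⟪ofCoord p x u, ofCoord p x v⟫_ℝ := by
    rintro z rfl; rfl
  rw [chartMetric_apply]
  exact this _ ((extChartAt 𝓘(ℝ, E) p).left_inv hx)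

/-- A Riemannian metric in a chart is a smooth metric on the target of the chart. -/
theorem isMetricOn_chartMetric [FiniteDimensional ℝ E]
    [IsContMDiffRiemannianBundle 𝓘(ℝ, E) ∞ E (fun x : M ↦ TangentSpace 𝓘(ℝ, E) x)] (p : M) :
    IsMetricOn (chartMetric (E := E) p) (extChartAt 𝓘(ℝ, E) p).target where
  isOpen := isOpen_extChartAt_target p
  contDiffOn := by
    rw [contDiffOn_clm_apply]
    intro u
    rw [contDiffOn_clm_apply]
    intro v
    have hframe (u : E) : ContMDiffOn 𝓘(ℝ, E) (𝓘(ℝ, E).prod 𝓘(ℝ, E)) ∞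
        (fun y ↦ (⟨(extChartAt 𝓘(ℝ, E) p).symm y, ofCoord p ((extChartAt 𝓘(ℝ, E) p).symm y) u⟩ :
          TangentBundle 𝓘(ℝ, E) M)) (extChartAt 𝓘(ℝ, E) p).target := by
      rw [(trivializationAt E (TangentSpace 𝓘(ℝ, E) : M → Type _) p).contMDiffOn_iff]
      · refine ⟨contMDiffOn_extChartAt_symm p, (contMDiffOn_const (c := u)).congr fun y hy ↦ ?_⟩
        have hb := mem_baseSet_of_mem_source ((extChartAt 𝓘(ℝ, E) p).map_target hy)
        have := toCoord_ofCoord ((extChartAt 𝓘(ℝ, E) p).map_target hy) u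
        rwa [toCoord, Trivialization.continuousLinearMapAt_apply,
          Trivialization.linearMapAt_apply, if_pos hb] at this
      · intro y hy
        rw [Trivialization.mem_source]
        exact mem_baseSet_of_mem_source ((extChartAt 𝓘(ℝ, E) p).map_target hy)
    exact contMDiffOn_iff_contDiffOn.1 (ContMDiffOn.inner_bundle
      (E := fun x : M ↦ TangentSpace 𝓘(ℝ, E) x) (hframe u) (hframe v))
  symm y _ u v := by
    rw [chartMetric_apply, chartMetric_apply, real_inner_comm]
  pos y hy u hu := by
    rw [chartMetric_apply]
    refine real_inner_self_pos.2 fun h0 ↦ hu ?_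
    rw [← toCoord_ofCoord ((extChartAt 𝓘(ℝ, E) p).map_target hy) u, h0, map_zero]

end Metric

end Chart

section Immersion

variable {E : Type*} [NormedAddCommGroup E] [NormedSpace ℝ E]
  {M : Type*} [TopologicalSpace M] [ChartedSpace E M] [IsManifold 𝓘(ℝ, E) ∞ M]
  {F : Type*} [NormedAddCommGroup F] [NormedSpace ℝ F]
  {N : Type*} [TopologicalSpace N] [ChartedSpace F N] [IsManifold 𝓘(ℝ, F) ∞ N]

/-- The coordinate expression of the differential of `f` in the charts at `x` and `f x`. -/
theorem toCoord_mfderiv_ofCoord {f : M → N} (hf : MDifferentiable 𝓘(ℝ, E) 𝓘(ℝ, F) f) (x : M)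
    {y : E} (hy : y ∈ (extChartAt 𝓘(ℝ, E) x).target)
    (hfy : f ((extChartAt 𝓘(ℝ, E) x).symm y) ∈ (extChartAt 𝓘(ℝ, F) (f x)).source) (u : E) :
    toCoord (f x) (f ((extChartAt 𝓘(ℝ, E) x).symm y))
      (mfderiv 𝓘(ℝ, E) 𝓘(ℝ, F) f ((extChartAt 𝓘(ℝ, E) x).symm y)
        (ofCoord x ((extChartAt 𝓘(ℝ, E) x).symm y) u)) =
      fderiv ℝ (writtenInExtChartAt 𝓘(ℝ, E) 𝓘(ℝ, F) x f) y u := by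
  have hsrc := (extChartAt 𝓘(ℝ, E) x).map_target hy
  have h1 : MDifferentiableAt 𝓘(ℝ, E) 𝓘(ℝ, E) (extChartAt 𝓘(ℝ, E) x).symm y :=
    ((contMDiffOn_extChartAt_symm (n := ∞) x).contMDiffAt
      ((isOpen_extChartAt_target x).mem_nhds hy)).mdifferentiableAt (by simp)
  have h3 : MDifferentiableAt 𝓘(ℝ, F) 𝓘(ℝ, F) (extChartAt 𝓘(ℝ, F) (f x))
      (f ((extChartAt 𝓘(ℝ, E) x).symm y)) := mdifferentiableAt_extChartAt (by simpa using hfy)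
  rw [ofCoord, TangentBundle.symmL_trivializationAt (by simpa using hsrc),
    toCoord, TangentBundle.continuousLinearMapAt_trivializationAt (by simpa using hfy),
    (extChartAt 𝓘(ℝ, E) x).right_inv hy, ← mfderiv_eq_fderiv]
  have h2 := hf ((extChartAt 𝓘(ℝ, E) x).symm y)
  have := mfderiv_comp y h3 (h2.comp y h1)
  rw [mfderiv_comp y h2 h1] at this
  simp only [modelWithCornersSelf_coe, Set.range_id, mfderivWithin_univ]
  exact (DFunLike.congr_fun this u).symm

/-- The differential of `f` in the charts at `x` and `f x`. -/
theorem mfderiv_ofCoord {f : M → N} (hf : MDifferentiable 𝓘(ℝ, E) 𝓘(ℝ, F) f) (x : M) (u : E) :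
    mfderiv 𝓘(ℝ, E) 𝓘(ℝ, F) f x (ofCoord x x u) = ofCoord (f x) (f x)
      (fderiv ℝ (writtenInExtChartAt 𝓘(ℝ, E) 𝓘(ℝ, F) x f) (extChartAt 𝓘(ℝ, E) x x) u) := by
  -- the tangent spaces depend on the base point, so the base point is generalized
  have key : ∀ z, z = x → f z ∈ (extChartAt 𝓘(ℝ, F) (f x)).source →
      toCoord (f x) (f z) (mfderiv 𝓘(ℝ, E) 𝓘(ℝ, F) f z (ofCoord x z u)) =
      toCoord (f x) (f x) (mfderiv 𝓘(ℝ, E) 𝓘(ℝ, F) f x (ofCoord x x u)) := by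
    rintro z rfl _; rfl
  have hx : (extChartAt 𝓘(ℝ, E) x).symm (extChartAt 𝓘(ℝ, E) x x) = x := by simp
  have hfx : f ((extChartAt 𝓘(ℝ, E) x).symm (extChartAt 𝓘(ℝ, E) x x)) ∈
      (extChartAt 𝓘(ℝ, F) (f x)).source := by simp
  rw [← toCoord_mfderiv_ofCoord hf x (mem_extChartAt_target x) hfx u, key _ hx hfx,
    ofCoord_toCoord (mem_extChartAt_source (f x))]

variable [RiemannianBundle (fun x : M ↦ TangentSpace 𝓘(ℝ, E) x)]
  [RiemannianBundle (fun x : N ↦ TangentSpace 𝓘(ℝ, F) x)]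
  [FiniteDimensional ℝ E] [FiniteDimensional ℝ F]
  [IsContMDiffRiemannianBundle 𝓘(ℝ, E) ∞ E (fun x : M ↦ TangentSpace 𝓘(ℝ, E) x)]
  [IsContMDiffRiemannianBundle 𝓘(ℝ, F) ∞ F (fun x : N ↦ TangentSpace 𝓘(ℝ, F) x)]
  {f : M → N}

namespace IsIsometricImmersion

theorem isLocalIsometry (hf : IsIsometricImmersion E F f) (x : M) :
    IsLocalIsometry (chartMetric (E := E) x)
      ((extChartAt 𝓘(ℝ, E) x).target ∩
        (extChartAt 𝓘(ℝ, E) x).symm ⁻¹' (f ⁻¹' (extChartAt 𝓘(ℝ, F) (f x)).source))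
      (chartMetric (E := F) (f x)) (extChartAt 𝓘(ℝ, F) (f x)).target
      (writtenInExtChartAt 𝓘(ℝ, E) 𝓘(ℝ, F) x f) where
  source :=
    { isOpen := (continuousOn_extChartAt_symm x).isOpen_inter_preimage
        (isOpen_extChartAt_target x)
        ((isOpen_extChartAt_source (f x)).preimage hf.contMDiff.continuous)
      contDiffOn := (isMetricOn_chartMetric x).contDiffOn.mono Set.inter_subset_left
      symm y hy := (isMetricOn_chartMetric x).symm y hy.1
      pos y hy := (isMetricOn_chartMetric x).pos y hy.1 }
  target := isMetricOn_chartMetric (f x)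
  mapsTo y hy := (extChartAt 𝓘(ℝ, F) (f x)).map_source hy.2
  contDiffOn := (contMDiff_iff.1 hf.contMDiff).2 x (f x)
  isometry y hy u v := by
    have hd : MDifferentiable 𝓘(ℝ, E) 𝓘(ℝ, F) f := hf.contMDiff.mdifferentiable (by simp)
    have e : writtenInExtChartAt 𝓘(ℝ, E) 𝓘(ℝ, F) x f y =
      extChartAt 𝓘(ℝ, F) (f x) (f ((extChartAt 𝓘(ℝ, E) x).symm y)) := rfl
    rw [e, chartMetric_extChartAt hy.2, ← toCoord_mfderiv_ofCoord hd x hy.1 hy.2,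
      ← toCoord_mfderiv_ofCoord hd x hy.1 hy.2, ofCoord_toCoord hy.2, ofCoord_toCoord hy.2,
      hf.inner_eq, chartMetric_apply]

end IsIsometricImmersion

end Immersion

section Coordinates

variable {E : Type*} [NormedAddCommGroup E] [NormedSpace ℝ E]
  {M : Type*} [TopologicalSpace M] [ChartedSpace E M]
  {F : Type*} [NormedAddCommGroup F] [NormedSpace ℝ F]
  {N : Type*} [TopologicalSpace N] [ChartedSpace F N]

theorem extChartAt_mem_target_inter_preimage (f : M → N) (x : M) :
    extChartAt 𝓘(ℝ, E) x x ∈ (extChartAt 𝓘(ℝ, E) x).target ∩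
      (extChartAt 𝓘(ℝ, E) x).symm ⁻¹' (f ⁻¹' (extChartAt 𝓘(ℝ, F) (f x)).source) :=
  ⟨mem_extChartAt_target x, by simp⟩

theorem writtenInExtChartAt_self (f : M → N) (x : M) :
    writtenInExtChartAt 𝓘(ℝ, E) 𝓘(ℝ, F) x f (extChartAt 𝓘(ℝ, E) x x) =
      extChartAt 𝓘(ℝ, F) (f x) (f x) := by
  simp [writtenInExtChartAt]

end Coordinates

section Immersion

variable {E : Type*} [NormedAddCommGroup E] [NormedSpace ℝ E]
  {M : Type*} [TopologicalSpace M] [ChartedSpace E M] [IsManifold 𝓘(ℝ, E) ∞ M]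
  {F : Type*} [NormedAddCommGroup F] [NormedSpace ℝ F]
  {N : Type*} [TopologicalSpace N] [ChartedSpace F N] [IsManifold 𝓘(ℝ, F) ∞ N]
  [RiemannianBundle (fun x : M ↦ TangentSpace 𝓘(ℝ, E) x)]
  [RiemannianBundle (fun x : N ↦ TangentSpace 𝓘(ℝ, F) x)]
  {f : M → N}

namespace IsIsometricImmersion

theorem toCoord_mfderiv (hf : IsIsometricImmersion E F f) (x : M) (X : TangentSpace 𝓘(ℝ, E) x) :
    toCoord (f x) (f x) (mfderiv 𝓘(ℝ, E) 𝓘(ℝ, F) f x X) =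
      fderiv ℝ (writtenInExtChartAt 𝓘(ℝ, E) 𝓘(ℝ, F) x f) (extChartAt 𝓘(ℝ, E) x x)
        (toCoord x x X) := by
  have := mfderiv_ofCoord (hf.contMDiff.mdifferentiable (by simp)) x (toCoord x x X)
  rw [ofCoord_toCoord (mem_extChartAt_source x)] at this
  rw [this, toCoord_ofCoord (mem_extChartAt_source (f x))]

variable [FiniteDimensional ℝ E] [FiniteDimensional ℝ F]
  [IsContMDiffRiemannianBundle 𝓘(ℝ, E) ∞ E (fun x : M ↦ TangentSpace 𝓘(ℝ, E) x)]
  [IsContMDiffRiemannianBundle 𝓘(ℝ, F) ∞ F (fun x : N ↦ TangentSpace 𝓘(ℝ, F) x)]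

/-- The second fundamental form is the second form of the coordinate expression of `f`. -/
theorem secondFundamentalForm_eq (hf : IsIsometricImmersion E F f) (x : M)
    (X Y : TangentSpace 𝓘(ℝ, E) x) :
    secondFundamentalForm F f x X Y = ofCoord (f x) (f x)
      (IsLocalIsometry.secondForm (chartMetric (E := E) x) (chartMetric (E := F) (f x))
        (writtenInExtChartAt 𝓘(ℝ, E) 𝓘(ℝ, F) x f) (extChartAt 𝓘(ℝ, E) x x)
        (toCoord x x X) (toCoord x x Y)) := by
  have hd : MDifferentiable 𝓘(ℝ, E) 𝓘(ℝ, F) f := hf.contMDiff.mdifferentiable (by simp)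
  set K : Submodule ℝ (TangentSpace 𝓘(ℝ, F) (f x)) :=
    (mfderiv 𝓘(ℝ, E) 𝓘(ℝ, F) f x : TangentSpace 𝓘(ℝ, E) x →ₗ[ℝ]
      TangentSpace 𝓘(ℝ, F) (f x)).range
  set G := chartMetric (E := E) x
  set G' := chartMetric (E := F) (f x)
  set φ := writtenInExtChartAt 𝓘(ℝ, E) 𝓘(ℝ, F) x f
  set y := extChartAt 𝓘(ℝ, E) x x
  set u := toCoord x x X
  set v := toCoord x x Y
  -- the ambient derivative is the sum of a normal and of a tangential vector
  have hsplit : ambientDeriv F f x X Y = ofCoord (f x) (f x)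
      (IsLocalIsometry.secondForm G G' φ y u v) +
      mfderiv 𝓘(ℝ, E) 𝓘(ℝ, F) f x (ofCoord x x (christoffel G y u v)) := by
    rw [mfderiv_ofCoord hd, ← map_add, IsLocalIsometry.secondForm, sub_add_cancel]
    rfl
  have htan : mfderiv 𝓘(ℝ, E) 𝓘(ℝ, F) f x (ofCoord x x (christoffel G y u v)) ∈ K := ⟨_, rfl⟩
  have hnor : ofCoord (f x) (f x) (IsLocalIsometry.secondForm G G' φ y u v) ∈ Kᗮ := by
    rw [Submodule.mem_orthogonal']
    rintro _ ⟨Z, rfl⟩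
    have h0 := (hf.isLocalIsometry x).inner_secondForm
      (extChartAt_mem_target_inter_preimage f x) u v (toCoord x x Z)
    rw [writtenInExtChartAt_self, chartMetric_extChartAt (mem_extChartAt_source (f x)),
      ← mfderiv_ofCoord hd, ofCoord_toCoord (mem_extChartAt_source x)] at h0
    exact h0
  rw [secondFundamentalForm, hsplit, map_add]
  exact (congrArg₂ (· + ·) (Submodule.starProjection_eq_self_iff.2 hnor)
    ((Submodule.starProjection_apply_eq_zero_iff (K := Kᗮ)).2
      (Submodule.le_orthogonal_orthogonal K htan))).trans (add_zero _)

theorem secondFundamentalForm_symm (hf : IsIsometricImmersion E F f) (x : M)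
    (X Y : TangentSpace 𝓘(ℝ, E) x) :
    secondFundamentalForm F f x X Y = secondFundamentalForm F f x Y X := by
  have h := hf.isLocalIsometry x
  have hy := extChartAt_mem_target_inter_preimage (E := E) (F := F) f x
  rw [hf.secondFundamentalForm_eq, hf.secondFundamentalForm_eq, IsLocalIsometry.secondForm,
    IsLocalIsometry.secondForm, covDerivImage_symm h.target (h.contDiffAt hy) (h.mapsTo hy),
    h.source.christoffel_symm hy]

/-- The Gauss equation for sectional curvatures. -/
theorem sectional_eq (hf : IsIsometricImmersion E F f) (x : M) (X Y : TangentSpace 𝓘(ℝ, E) x) :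
    sectional x X Y =
      sectional (f x) (mfderiv 𝓘(ℝ, E) 𝓘(ℝ, F) f x X) (mfderiv 𝓘(ℝ, E) 𝓘(ℝ, F) f x Y)
      + ⟪secondFundamentalForm F f x X X, secondFundamentalForm F f x Y Y⟫_ℝ
      - ‖secondFundamentalForm F f x X Y‖ ^ 2 := by
  have hG := (hf.isLocalIsometry x).gauss (extChartAt_mem_target_inter_preimage f x)
    (toCoord x x X) (toCoord x x Y) (toCoord x x Y) (toCoord x x X)
  simp only [writtenInExtChartAt_self, chartMetric_extChartAt (mem_extChartAt_source x),
    chartMetric_extChartAt (mem_extChartAt_source (f x)), ← hf.secondFundamentalForm_eq,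
    ← hf.toCoord_mfderiv, ofCoord_toCoord (mem_extChartAt_source x),
    ofCoord_toCoord (mem_extChartAt_source (f x))] at hG
  rw [hf.secondFundamentalForm_symm x Y X, real_inner_self_eq_norm_sq,
    real_inner_comm (secondFundamentalForm F f x X X)] at hG
  exact hG

end IsIsometricImmersion

end Immersion

/-! ### Mixed scalar curvature and mean curvature -/

section Traces

variable {E : Type*} [NormedAddCommGroup E] [NormedSpace ℝ E]
  {M : Type*} [TopologicalSpace M] [ChartedSpace E M] [IsManifold 𝓘(ℝ, E) ∞ M]
  {F : Type*} [NormedAddCommGroup F] [NormedSpace ℝ F]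
  {N : Type*} [TopologicalSpace N] [ChartedSpace F N] [IsManifold 𝓘(ℝ, F) ∞ N]
  [RiemannianBundle (fun x : N ↦ TangentSpace 𝓘(ℝ, F) x)]
  [FiniteDimensional ℝ F]

/-- The second fundamental form as a bilinear map. -/
noncomputable def secondFundamentalFormBilin (f : M → N) (x : M) :
    TangentSpace 𝓘(ℝ, E) x →ₗ[ℝ] TangentSpace 𝓘(ℝ, E) x →ₗ[ℝ] TangentSpace 𝓘(ℝ, F) (f x) :=
  LinearMap.mk₂ ℝ (secondFundamentalForm F f x)
    (by intro X X' Y; simp only [secondFundamentalForm, ambientDeriv, ← map_add]; congr 2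
        simp only [map_add, add_apply]; abel)
    (by intro r X Y; simp only [secondFundamentalForm, ambientDeriv, ← map_smul]; congr 2
        simp [smul_add])
    (by intro X Y Y'; simp only [secondFundamentalForm, ambientDeriv, ← map_add]; congr 2
        simp only [map_add]; abel)
    (by intro r X Y; simp only [secondFundamentalForm, ambientDeriv, ← map_smul]; congr 2
        simp [smul_add])

/-- The second fundamental form vanishes on a pair of subspaces as soon as it vanishes on bases. -/
theorem secondFundamentalForm_eq_zero_of_basis (f : M → N) (x : M)
    {V W : Submodule ℝ (TangentSpace 𝓘(ℝ, E) x)} {ι κ : Type*} (b : Module.Basis ι ℝ V)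
    (c : Module.Basis κ ℝ W)
    (h : ∀ i j, secondFundamentalForm F f x (b i : TangentSpace 𝓘(ℝ, E) x)
      (c j : TangentSpace 𝓘(ℝ, E) x) = 0)
    {X Y : TangentSpace 𝓘(ℝ, E) x} (hX : X ∈ V) (hY : Y ∈ W) :
    secondFundamentalForm F f x X Y = 0 := by
  have : (secondFundamentalFormBilin (F := F) f x).compl₁₂ V.subtype W.subtype = 0 :=
    b.ext fun i ↦ c.ext fun j ↦ h i j
  exact congrArg (fun T : V →ₗ[ℝ] W →ₗ[ℝ] TangentSpace 𝓘(ℝ, F) (f x) ↦ T ⟨X, hX⟩ ⟨Y, hY⟩) this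

variable [FiniteDimensional ℝ E] [RiemannianBundle (fun x : M ↦ TangentSpace 𝓘(ℝ, E) x)]

/-- The mean curvature vector of a subspace can be computed in any orthonormal basis. -/
theorem partialMeanCurvature_eq (f : M → N) (x : M)
    (V : Submodule ℝ (TangentSpace 𝓘(ℝ, E) x)) {ι : Type*} [Fintype ι]
    (b : OrthonormalBasis ι ℝ V) :
    partialMeanCurvature F f x V = ∑ i, secondFundamentalForm F f x
      (b i : TangentSpace 𝓘(ℝ, E) x) (b i : TangentSpace 𝓘(ℝ, E) x) := by
  refine ext_inner_left ℝ fun ν ↦ ?_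
  rw [partialMeanCurvature, inner_sum, inner_sum]
  exact sum_bilin_orthonormalBasis
    (((secondFundamentalFormBilin (F := F) f x).compl₁₂ V.subtype V.subtype).compr₂ (innerₗ _ ν))
    (stdOrthonormalBasis ℝ V) b

/-- The mean curvature vector is the sum of the mean curvature vectors of complementary orthogonal
subspaces. -/
theorem meanCurvature_eq_sum (f : M → N) (x : M) {ι : Type*} [Fintype ι]
    {V : ι → Submodule ℝ (TangentSpace 𝓘(ℝ, E) x)} (hV : ∀ i j, i ≠ j → V i ⟂ V j)
    (htop : ⨆ i, V i = ⊤) :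
    meanCurvature E F f x = ∑ i, partialMeanCurvature F f x (V i) := by
  classical
  have hfam : OrthogonalFamily ℝ (fun i ↦ V i) fun i ↦ (V i).subtypeₗᵢ :=
    OrthogonalFamily.of_pairwise fun i j hij ↦ hV i j hij
  have hint : DirectSum.IsInternal V := by
    rw [hfam.isInternal_iff, htop, Submodule.top_orthogonal_eq_bot]
  let b := hint.collectedOrthonormalBasis hfam fun i ↦ stdOrthonormalBasis ℝ (V i)
  rw [meanCurvature, partialMeanCurvature_eq f x ⊤
    (b.map (LinearIsometryEquiv.ofTop _ ⊤ rfl).symm), Fintype.sum_sigma]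
  refine Finset.sum_congr rfl fun i _ ↦ Finset.sum_congr rfl fun a _ ↦ ?_
  have : ((b.map (LinearIsometryEquiv.ofTop _ ⊤ rfl).symm ⟨i, a⟩ :
      (⊤ : Submodule ℝ (TangentSpace 𝓘(ℝ, E) x))) : TangentSpace 𝓘(ℝ, E) x) =
      stdOrthonormalBasis ℝ (V i) a := by
    simp [b, DirectSum.IsInternal.collectedOrthonormalBasis]
  rw [this]

namespace IsIsometricImmersion

variable {f : M → N}

/-- The isometry between a subspace of `T_x M` and its image under the differential of `f`. -/
noncomputable def pushforwardEquiv (hf : IsIsometricImmersion E F f) (x : M)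
    (V : Submodule ℝ (TangentSpace 𝓘(ℝ, E) x)) : V ≃ₗᵢ[ℝ] pushforward F f x V :=
  let T : TangentSpace 𝓘(ℝ, E) x →ₗᵢ[ℝ] TangentSpace 𝓘(ℝ, F) (f x) :=
    LinearMap.isometryOfInner (mfderiv 𝓘(ℝ, E) 𝓘(ℝ, F) f x : TangentSpace 𝓘(ℝ, E) x →ₗ[ℝ]
      TangentSpace 𝓘(ℝ, F) (f x)) (hf.inner_eq x)
  ⟨Submodule.equivMapOfInjective T.toLinearMap T.injective V, fun X ↦ T.norm_map X⟩

variable [IsContMDiffRiemannianBundle 𝓘(ℝ, E) ∞ E (fun x : M ↦ TangentSpace 𝓘(ℝ, E) x)]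
  [IsContMDiffRiemannianBundle 𝓘(ℝ, F) ∞ F (fun x : N ↦ TangentSpace 𝓘(ℝ, F) x)]

/-- The Gauss equation, traced over a pair of subspaces. -/
theorem mixedScalarPair_eq (hf : IsIsometricImmersion E F f) (x : M)
    (V W : Submodule ℝ (TangentSpace 𝓘(ℝ, E) x)) :
    mixedScalarPair x V W =
      mixedScalarPair (f x) (pushforward F f x V) (pushforward F f x W)
      + ⟪partialMeanCurvature F f x V, partialMeanCurvature F f x W⟫_ℝ
      - ∑ a, ∑ b, ‖secondFundamentalForm F f x
          (stdOrthonormalBasis ℝ V a : TangentSpace 𝓘(ℝ, E) x)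
          (stdOrthonormalBasis ℝ W b : TangentSpace 𝓘(ℝ, E) x)‖ ^ 2 := by
  have hpush : ∀ (V : Submodule ℝ (TangentSpace 𝓘(ℝ, E) x)) (X : V),
      (hf.pushforwardEquiv x V X : TangentSpace 𝓘(ℝ, F) (f x)) =
        mfderiv 𝓘(ℝ, E) 𝓘(ℝ, F) f x (X : TangentSpace 𝓘(ℝ, E) x) := fun _ _ ↦ rfl
  rw [AlmostProduct.mixedScalarPair_eq (f x) _ _
    ((stdOrthonormalBasis ℝ V).map (hf.pushforwardEquiv x V))
    ((stdOrthonormalBasis ℝ W).map (hf.pushforwardEquiv x W))]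
  simp only [mixedScalarPair, partialMeanCurvature, sum_inner, inner_sum,
    OrthonormalBasis.map_apply, hpush, hf.sectional_eq x,
    Finset.sum_add_distrib, Finset.sum_sub_distrib]
  rw [Finset.sum_comm (f := fun a b ↦ ⟪secondFundamentalForm F f x _ _, _⟫_ℝ)]

end IsIsometricImmersion

end Traces

/-! ### The optimal inequality -/

theorem sum_sum_lt_eq_of_symm {k : ℕ} (s : Fin k → Fin k → ℝ) (hs : ∀ i j, s i j = s j i) :
    ∑ i, ∑ j, (if i < j then s i j else 0) = (∑ i, ∑ j, s i j - ∑ i, s i i) / 2 := by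
  have h1 : ∑ i, ∑ j, s i j = ∑ i, ∑ j, (if i < j then s i j else 0)
      + ∑ i, ∑ j, (if j < i then s i j else 0) + ∑ i, s i i := by
    simp only [← Finset.sum_add_distrib]
    refine Finset.sum_congr rfl fun i _ ↦ ?_
    have h (j : Fin k) : s i j = (if i < j then s i j else 0) + (if j < i then s i j else 0)
        + (if i = j then s i j else 0) := by
      rcases lt_trichotomy i j with h | h | h
      · simp [h, h.not_gt, h.ne]
      · simp [h]
      · simp [h, h.not_gt, h.ne']
    rw [Finset.sum_congr rfl fun j _ ↦ h j, Finset.sum_add_distrib]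
    simp [Finset.sum_add_distrib]
  have h2 : ∑ i, ∑ j, (if j < i then s i j else 0) = ∑ i, ∑ j, (if i < j then s i j else 0) := by
    rw [Finset.sum_comm]
    exact Finset.sum_congr rfl fun i _ ↦ Finset.sum_congr rfl fun j _ ↦ by rw [hs j i]
  rw [h1, h2]; ring

/-- The sum of the mixed inner products of `k` vectors, in terms of their sum and of their mutual
distances. -/
theorem sum_inner_lt_eq {T : Type*} [NormedAddCommGroup T] [InnerProductSpace ℝ T] {k : ℕ}
    (hk : k ≠ 0) (H : Fin k → T) :
    ∑ i, ∑ j, (if i < j then ⟪H i, H j⟫_ℝ else 0) =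
      (k - 1 : ℝ) / (2 * k) * ‖∑ i, H i‖ ^ 2
      - 1 / (2 * k) * ∑ i, ∑ j, (if i < j then ‖H i - H j‖ ^ 2 else 0) := by
  rw [sum_sum_lt_eq_of_symm _ fun i j ↦ real_inner_comm (H j) (H i),
    sum_sum_lt_eq_of_symm _ fun i j ↦ by rw [norm_sub_rev]]
  have h1 : ‖∑ i, H i‖ ^ 2 = ∑ i, ∑ j, ⟪H i, H j⟫_ℝ := by
    rw [← real_inner_self_eq_norm_sq, sum_inner]
    simp only [inner_sum]
  have h2 : ∑ i, ∑ j, ‖H i - H j‖ ^ 2 =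
      2 * k * ∑ i, ‖H i‖ ^ 2 - 2 * ∑ i, ∑ j, ⟪H i, H j⟫_ℝ := by
    simp only [norm_sub_sq_real, Finset.sum_add_distrib, Finset.sum_sub_distrib,
      ← Finset.mul_sum, Finset.sum_const, Finset.card_univ, Fintype.card_fin, nsmul_eq_mul]
    ring
  have hk' : (k : ℝ) ≠ 0 := by exact_mod_cast hk
  simp only [h1, h2, real_inner_self_eq_norm_sq, sub_self, norm_zero]
  field_simp
  simp
  ring

/-- From `s + d = S + c` with `d ≥ 0` and `S ≤ δ`, the bound `s ≤ c + δ` and its equality case. For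
`δ = ⊤` neither side of the equivalence holds, as `s` and `S` are finite. -/
theorem coe_le_add_and_coe_eq_add_iff {s S c d : ℝ} {δ : EReal} (h : s + d = S + c) (hd : 0 ≤ d)
    (hS : (S : EReal) ≤ δ) :
    (s : EReal) ≤ (c : EReal) + δ ∧ ((s : EReal) = (c : EReal) + δ ↔ d = 0 ∧ (S : EReal) = δ) := by
  induction δ with
  | bot => simp at hS
  | top => simp
  | coe δ =>
    norm_cast at hS ⊢
    refine ⟨by linarith, fun h' ↦ ⟨by linarith, by linarith⟩, fun h' ↦ by linarith [h'.1, h'.2]⟩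

section Defect

variable {E : Type*} [NormedAddCommGroup E] [NormedSpace ℝ E]
  {M : Type*} [TopologicalSpace M] [ChartedSpace E M] [IsManifold 𝓘(ℝ, E) ∞ M]
  {F : Type*} [NormedAddCommGroup F] [NormedSpace ℝ F]
  {N : Type*} [TopologicalSpace N] [ChartedSpace F N] [IsManifold 𝓘(ℝ, F) ∞ N]
  [RiemannianBundle (fun x : M ↦ TangentSpace 𝓘(ℝ, E) x)]
  [RiemannianBundle (fun x : N ↦ TangentSpace 𝓘(ℝ, F) x)]
  [FiniteDimensional ℝ F] {k : ℕ} {f : M → N}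
  {D : Fin k → (x : M) → Submodule ℝ (TangentSpace 𝓘(ℝ, E) x)}

/-- The images of the distributions compete in the supremum defining `δ̂_mix`, as the differential
of `f` is injective. -/
theorem IsIsometricImmersion.mixedScalar_pushforward_le_deltaHat
    (hf : IsIsometricImmersion E F f) {n : Fin k → ℕ}
    (hD : IsAlmostProduct n D) {D' : Fin k → (x : N) → Submodule ℝ (TangentSpace 𝓘(ℝ, F) x)}
    (hfD : IsAdapted f D D') (x : M) :
    ((mixedScalar (f x) (fun i ↦ pushforward F f x (D i x)) : ℝ) : EReal) ≤ deltaHat D' n := by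
  refine le_iSup_of_le (f x) (le_iSup_of_le (fun i ↦ pushforward F f x (D i x))
    (le_iSup_of_le (fun i ↦ ⟨?_, ?_⟩) le_rfl))
  · rintro _ ⟨X, hX, rfl⟩
    exact hfD i x X hX
  · rw [← (hD.isDistribution i).finrank_eq x]
    exact (hf.pushforwardEquiv x (D i x)).toLinearEquiv.finrank_eq.symm

variable [FiniteDimensional ℝ E]

variable (F) in
/-- The amount by which the mixed scalar curvature of `V_1, …, V_k` falls short of its bound
`S_mix(f_* V_1, …, f_* V_k) + (k - 1) / (2 k) ‖H‖²`: the mutual distances of the partial mean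
curvatures and the mixed part of the second fundamental form. -/
noncomputable def mixedDefect (f : M → N) (x : M)
    (V : Fin k → Submodule ℝ (TangentSpace 𝓘(ℝ, E) x)) : ℝ :=
  1 / (2 * k) * ∑ i, ∑ j, (if i < j then
    ‖partialMeanCurvature F f x (V i) - partialMeanCurvature F f x (V j)‖ ^ 2 else 0)
  + ∑ i, ∑ j, (if i < j then ∑ a, ∑ b, ‖secondFundamentalForm F f x
      (stdOrthonormalBasis ℝ (V i) a : TangentSpace 𝓘(ℝ, E) x)
      (stdOrthonormalBasis ℝ (V j) b : TangentSpace 𝓘(ℝ, E) x)‖ ^ 2 else 0)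

theorem mixedDefect_nonneg (f : M → N) (x : M)
    (V : Fin k → Submodule ℝ (TangentSpace 𝓘(ℝ, E) x)) : 0 ≤ mixedDefect F f x V := by
  refine add_nonneg (mul_nonneg (by positivity) ?_) ?_ <;>
  exact Finset.sum_nonneg fun i _ ↦ Finset.sum_nonneg fun j _ ↦ by split_ifs <;> positivity

variable [IsContMDiffRiemannianBundle 𝓘(ℝ, E) ∞ E (fun x : M ↦ TangentSpace 𝓘(ℝ, E) x)]
  [IsContMDiffRiemannianBundle 𝓘(ℝ, F) ∞ F (fun x : N ↦ TangentSpace 𝓘(ℝ, F) x)]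

namespace IsIsometricImmersion

theorem mixedDefect_eq_zero_iff (hf : IsIsometricImmersion E F f) (hk : k ≠ 0) (x : M) :
    mixedDefect F f x (fun i ↦ D i x) = 0 ↔ IsMixedTotallyGeodesicAt F f D x ∧
      ∀ i j, partialMeanCurvature F f x (D i x) = partialMeanCurvature F f x (D j x) := by
  have hk' : (0 : ℝ) < 1 / (2 * k) := by positivity
  rw [mixedDefect, add_eq_zero_iff_of_nonneg
    (mul_nonneg hk'.le <| Finset.sum_nonneg fun i _ ↦ Finset.sum_nonneg fun j _ ↦ by
      split_ifs <;> positivity)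
    (Finset.sum_nonneg fun i _ ↦ Finset.sum_nonneg fun j _ ↦ by split_ifs <;> positivity),
    mul_eq_zero_iff_left hk'.ne', and_comm]
  -- a sum over `i < j` of nonnegative terms vanishes iff all of them vanish
  have hsum : ∀ s : Fin k → Fin k → ℝ, (∀ i j, 0 ≤ s i j) →
      (∑ i, ∑ j, (if i < j then s i j else 0) = 0 ↔ ∀ i j, i < j → s i j = 0) := fun s hs ↦ by
    have h0 : ∀ i j, 0 ≤ if i < j then s i j else 0 := fun i j ↦ by
      split_ifs
      exacts [hs i j, le_rfl]
    simp [Finset.sum_eq_zero_iff_of_nonneg, Finset.sum_nonneg, h0]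
  rw [hsum _ fun i j ↦ by positivity, hsum _ fun i j ↦ by positivity]
  refine and_congr ⟨fun h ↦ ?_, fun h i j hij ↦ ?_⟩ ⟨fun h i j ↦ ?_, fun h i j _ ↦ by simp [h i j]⟩
  · have hlt : ∀ i j, i < j → ∀ X ∈ D i x, ∀ Y ∈ D j x,
        secondFundamentalForm F f x X Y = 0 := fun i j hij X hX Y hY ↦ by
      refine secondFundamentalForm_eq_zero_of_basis f x (stdOrthonormalBasis ℝ (D i x)).toBasis
        (stdOrthonormalBasis ℝ (D j x)).toBasis (fun a b ↦ ?_) hX hY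
      have h' := h i j hij
      rw [Finset.sum_eq_zero_iff_of_nonneg fun _ _ ↦ by positivity] at h'
      have h'' := h' a (Finset.mem_univ a)
      rw [Finset.sum_eq_zero_iff_of_nonneg fun _ _ ↦ by positivity] at h''
      simpa using h'' b (Finset.mem_univ b)
    intro i j hij X hX Y hY
    rcases lt_or_gt_of_ne hij with hij | hij
    · exact hlt i j hij X hX Y hY
    · rw [hf.secondFundamentalForm_symm]
      exact hlt j i hij Y hY X hX
  · refine Finset.sum_eq_zero fun a _ ↦ Finset.sum_eq_zero fun b _ ↦ ?_
    simp [h i j hij.ne _ (stdOrthonormalBasis ℝ (D i x) a).2 _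
      (stdOrthonormalBasis ℝ (D j x) b).2]
  · have hlt : ∀ i j, i < j →
        partialMeanCurvature F f x (D i x) = partialMeanCurvature F f x (D j x) := fun i j hij ↦ by
      simpa [sub_eq_zero] using h i j hij
    rcases lt_trichotomy i j with hij | rfl | hij
    exacts [hlt i j hij, rfl, (hlt j i hij).symm]

/-- The Gauss equation, traced over all pairs of distributions. -/
theorem mixedScalar_add_mixedDefect (hf : IsIsometricImmersion E F f) (hk : k ≠ 0) {n : Fin k → ℕ}
    (hD : IsAlmostProduct n D) (x : M) :
    mixedScalar x (fun i ↦ D i x) + mixedDefect F f x (fun i ↦ D i x) =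
      mixedScalar (f x) (fun i ↦ pushforward F f x (D i x))
      + (k - 1 : ℝ) / (2 * k) * ‖meanCurvature E F f x‖ ^ 2 := by
  have h := sum_inner_lt_eq hk fun i ↦ partialMeanCurvature F f x (D i x)
  rw [← meanCurvature_eq_sum f x (fun i j hij ↦ hD.orthogonal i j hij x)
    (hD.complementary x)] at h
  have hS : mixedScalar x (fun i ↦ D i x) =
      mixedScalar (f x) (fun i ↦ pushforward F f x (D i x))
      + ∑ i, ∑ j, (if i < j then ⟪partialMeanCurvature F f x (D i x),
          partialMeanCurvature F f x (D j x)⟫_ℝ else 0)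
      - ∑ i, ∑ j, (if i < j then ∑ a, ∑ b, ‖secondFundamentalForm F f x
          (stdOrthonormalBasis ℝ (D i x) a : TangentSpace 𝓘(ℝ, E) x)
          (stdOrthonormalBasis ℝ (D j x) b : TangentSpace 𝓘(ℝ, E) x)‖ ^ 2 else 0) := by
    simp only [mixedScalar, hf.mixedScalarPair_eq x, ← Finset.sum_add_distrib,
      ← Finset.sum_sub_distrib]
    refine Finset.sum_congr rfl fun i _ ↦ Finset.sum_congr rfl fun j _ ↦ ?_
    split_ifs <;> simp
  rw [hS, mixedDefect]
  linarith

end IsIsometricImmersion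

end Defect

end AlmostProduct

theorem mainTheorem5
    {E : Type*} [NormedAddCommGroup E] [NormedSpace ℝ E] [FiniteDimensional ℝ E]
    {M : Type*} [TopologicalSpace M] [ChartedSpace E M] [IsManifold 𝓘(ℝ, E) ∞ M]
    [RiemannianBundle (fun x : M ↦ TangentSpace 𝓘(ℝ, E) x)]
    [IsContMDiffRiemannianBundle 𝓘(ℝ, E) ∞ E (fun x : M ↦ TangentSpace 𝓘(ℝ, E) x)]
    {F : Type*} [NormedAddCommGroup F] [NormedSpace ℝ F] [FiniteDimensional ℝ F]
    {N : Type*} [TopologicalSpace N] [ChartedSpace F N] [IsManifold 𝓘(ℝ, F) ∞ N]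
    [RiemannianBundle (fun x : N ↦ TangentSpace 𝓘(ℝ, F) x)]
    [IsContMDiffRiemannianBundle 𝓘(ℝ, F) ∞ F (fun x : N ↦ TangentSpace 𝓘(ℝ, F) x)]
    {k : ℕ} (hk : 2 ≤ k) (n m : Fin k → ℕ)
    (D : Fin k → (x : M) → Submodule ℝ (TangentSpace 𝓘(ℝ, E) x))
    (hD : AlmostProduct.IsAlmostProduct n D)
    (D' : Fin k → (x : N) → Submodule ℝ (TangentSpace 𝓘(ℝ, F) x))
    (hD' : AlmostProduct.IsAlmostProduct m D')
    (f : M → N) (hf : AlmostProduct.IsIsometricImmersion E F f)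
    (hfD : AlmostProduct.IsAdapted f D D') :
    -- the inequality
    (∀ x, ((AlmostProduct.mixedScalar x (fun i ↦ D i x) : ℝ) : EReal) ≤
      (((k - 1 : ℝ) / (2 * k) * ‖AlmostProduct.meanCurvature E F f x‖ ^ 2 : ℝ) : EReal)
        + AlmostProduct.deltaHat D' n) ∧
    -- the equality case at a given point
    (∀ x, ((AlmostProduct.mixedScalar x (fun i ↦ D i x) : ℝ) : EReal) =
        (((k - 1 : ℝ) / (2 * k) * ‖AlmostProduct.meanCurvature E F f x‖ ^ 2 : ℝ) : EReal)
          + AlmostProduct.deltaHat D' n ↔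
      AlmostProduct.IsMixedTotallyGeodesicAt F f D x ∧
      (∀ i j, AlmostProduct.partialMeanCurvature F f x (D i x) =
        AlmostProduct.partialMeanCurvature F f x (D j x)) ∧
      ((AlmostProduct.mixedScalar (f x)
        (fun i ↦ AlmostProduct.pushforward F f x (D i x)) : ℝ) : EReal) =
          AlmostProduct.deltaHat D' n) ∧
    -- the equality case on all of `M`
    ((∀ x, ((AlmostProduct.mixedScalar x (fun i ↦ D i x) : ℝ) : EReal) =
        (((k - 1 : ℝ) / (2 * k) * ‖AlmostProduct.meanCurvature E F f x‖ ^ 2 : ℝ) : EReal)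
          + AlmostProduct.deltaHat D' n) ↔
      AlmostProduct.IsMixedTotallyGeodesic F f D ∧
      (∀ x i j, AlmostProduct.partialMeanCurvature F f x (D i x) =
        AlmostProduct.partialMeanCurvature F f x (D j x)) ∧
      ∀ x, ((AlmostProduct.mixedScalar (f x)
        (fun i ↦ AlmostProduct.pushforward F f x (D i x)) : ℝ) : EReal) =
          AlmostProduct.deltaHat D' n) := by
  have key := fun x ↦ AlmostProduct.coe_le_add_and_coe_eq_add_iff
    (hf.mixedScalar_add_mixedDefect (by lia) hD x) (AlmostProduct.mixedDefect_nonneg f x _)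
    (hf.mixedScalar_pushforward_le_deltaHat hD hfD x)
  simp only [hf.mixedDefect_eq_zero_iff (by lia : k ≠ 0), and_assoc] at key
  refine ⟨fun x ↦ (key x).1, fun x ↦ (key x).2, ?_⟩
  rw [forall_congr' fun x ↦ (key x).2, forall_and, forall_and]
  rfl
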